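/- All graphs are finite and simple. For a graph $G$ let $m_G$ be its number of edges, $\mathbf d_G$ its degree vector, $L_G$ its Laplacian matrix, $L_G^\dagger$ the Moore--Penrose inverse of $L_G$, and $R_G=[r^G_{u,v}]$ the effective resistance matrix, $r^G_{u,v}=(\mathbf e_u-\mathbf e_v)^T L_G^\dagger(\mathbf e_u-\mathbf e_v)$. For a connected graph $G$ let $$\kappa(G)=\sum_{u}\sum_{v\ne u}\pi_u\, m_{u,v}\,\pi_v,\qquad \pi=\frac{1}{2m_G}\mathbf d_G,$$ be Kemeny's constant of the simple random walk on $G$, where $m_{u,v}$ is the mean first passage time from $u$ to $v$ (so $\kappa(G)=0$ if $G$ has one vertex). Let $\mathcal T$ be a tree with vertex set $\{1,\dots,k\}$ and let $G_1,\dots,G_k$ be connected graphs. For every edge $\{i,j\}$ of $\mathcal T$ choose a vertex $c_{i,j}\in V(G_i)$ and a vertex $c_{j,i}\in V(G_j)$; the vertices $c_{i,j}$ and $c_{i,j'}$ with $j\neq j'$ may coincide. Let $G$ be the chain of $G_1,\dots,G_k$ with respect to $\mathcal T$ given by these choices: the disjoint union of $G_1,\dots,G_k$ together with the $k-1$ edges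 (bridges) $c_{i,j}\sim c_{j,i}$, one for each edge $\{i,j\}$ of $\mathcal T$. For an edge $\{i,j\}$ of $\mathcal T$ let $W_{i,j}$ be the number of edges of the component containing $c_{i,j}$ of the graph obtained from $G$ by deleting the bridge $c_{i,j}\sim c_{j,i}$, and let $\overline W_{i,j}=m_G-W_{i,j}$. Then $$\begin{aligned} \kappa(G)=&\sum_{i=1}^k\frac{m_{G_i}}{m_G}\,\kappa(G_i)+\sum_{\{i,j\}\in E(\mathcal T)}\left(\frac{\overline W_{i,j}}{m_G}\,\mathbf d_{G_i}^TR_{G_i}\mathbf e_{c_{i,j}}+\frac{\overline W_{j,i}}{m_G}\,\mathbf d_{G_j}^TR_{G_j}\mathbf e_{c_{j,i}}\right)\\ &+\sum_{i=1}^k\ \sum_{j\sim_{\mathcal T} i}\ \sum_{j'\sim_{\mathcal T} i}\frac{\overline W_{i,j}\,\overline W_{i,j'}}{m_G}\,r^{G_i}_{c_{i,j},c_{i,j'}}+\sum_{\{i,j\}\in E(\mathcal T)}\frac{(2\overline W_{i,j}-1)(2\overline W_{j,i}-1)}{2m_G}, \end{aligned}$$ where in the third sum $j$ and $j'$ range independently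 over the neighbours of $i$ in $\mathcal T$. (If $G$ is a single vertex, so that $m_G=0$, both sides are read as $0$.) -/

import Mathlib

open scoped Matrix

noncomputable section

namespace KemenyChain

section MoorePenrose

variable {n : Type*} [Fintype n]

/-- The four Penrose equations for a real matrix `A` and a candidate `X`. -/
structure IsMoorePenroseInverse (A X : Matrix n n ℝ) : Prop where
  mul_mul_self : A * X * A = A
  self_mul_mul : X * A * X = X
  symm_left : (A * X)ᵀ = A * X
  symm_right : (X * A)ᵀ = X * A

/-- Uniqueness of the Moore–Penrose inverse. -/
theorem IsMoorePenroseInverse.unique {A X Y : Matrix n n ℝ}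
    (hX : IsMoorePenroseInverse A X) (hY : IsMoorePenroseInverse A Y) : X = Y := by
  have h1 : A * X = A * Y := by
    calc A * X = (A * X)ᵀ := hX.symm_left.symm
      _ = ((A * Y * A) * X)ᵀ := by rw [hY.mul_mul_self]
      _ = ((A * Y) * (A * X))ᵀ := by simp only [Matrix.mul_assoc]
      _ = (A * X) * (A * Y) := by rw [Matrix.transpose_mul, hX.symm_left, hY.symm_left]
      _ = (A * X * A) * Y := by simp only [Matrix.mul_assoc]
      _ = A * Y := by rw [hX.mul_mul_self]
  have h2 : X * A = Y * A := by
    calc X * A = (X * A)ᵀ := hX.symm_right.symm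
      _ = (X * (A * Y * A))ᵀ := by rw [hY.mul_mul_self]
      _ = ((X * A) * (Y * A))ᵀ := by simp only [Matrix.mul_assoc]
      _ = (Y * A) * (X * A) := by rw [Matrix.transpose_mul, hX.symm_right, hY.symm_right]
      _ = Y * (A * X * A) := by simp only [Matrix.mul_assoc]
      _ = Y * A := by rw [hX.mul_mul_self]
  calc X = X * A * X := hX.self_mul_mul.symm
    _ = Y * (A * X) := by rw [h2, Matrix.mul_assoc]
    _ = Y * A * Y := by rw [h1, Matrix.mul_assoc]
    _ = Y := hY.self_mul_mul

/-- A symmetric real matrix has a Moore–Penrose inverse. -/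
theorem exists_isMoorePenroseInverse {A : Matrix n n ℝ} (hA : A.IsSymm) :
    ∃ X, IsMoorePenroseInverse A X := by
  classical
  have hH : A.IsHermitian := by
    rw [Matrix.IsHermitian, Matrix.conjTranspose_eq_transpose_of_trivial]; exact hA
  obtain ⟨U, D, hU, hAD⟩ : ∃ (U : Matrix n n ℝ) (D : n → ℝ),
      Uᵀ * U = 1 ∧ A = U * Matrix.diagonal D * Uᵀ := by
    refine ⟨hH.eigenvectorUnitary, hH.eigenvalues, ?_, ?_⟩
    · have := Unitary.coe_star_mul_self hH.eigenvectorUnitary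
      simpa [Matrix.star_eq_conjTranspose] using this
    · have := hH.spectral_theorem
      rw [Unitary.conjStarAlgAut_apply] at this
      simpa [Matrix.star_eq_conjTranspose] using this
  have key : ∀ E F : n → ℝ, (U * Matrix.diagonal E * Uᵀ) * (U * Matrix.diagonal F * Uᵀ)
      = U * Matrix.diagonal (fun i => E i * F i) * Uᵀ := by
    intro E F
    calc _ = U * Matrix.diagonal E * (Uᵀ * U) * Matrix.diagonal F * Uᵀ := by
          simp only [Matrix.mul_assoc]
      _ = _ := by rw [hU, Matrix.mul_one, Matrix.mul_assoc U, Matrix.diagonal_mul_diagonal]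
  have symm : ∀ E : n → ℝ, (U * Matrix.diagonal E * Uᵀ)ᵀ = U * Matrix.diagonal E * Uᵀ := by
    intro E; simp [Matrix.transpose_mul, Matrix.mul_assoc]
  refine ⟨U * Matrix.diagonal (fun i => (D i)⁻¹) * Uᵀ, ?_, ?_, ?_, ?_⟩ <;> subst hAD
  · rw [key, key]; congr; ext i; exact mul_inv_mul_cancel (D i)
  · rw [key, key]; congr; ext i
    by_cases h : D i = 0 <;> simp [h]
  · rw [key, symm]
  · rw [key, symm]

/-- The Moore–Penrose inverse `A†`; it exists (and is unique) for every symmetric `A`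
by the two preceding facts. -/
def moorePenrose (A : Matrix n n ℝ) : Matrix n n ℝ :=
  Classical.epsilon (IsMoorePenroseInverse A)

theorem isMoorePenroseInverse_moorePenrose {A : Matrix n n ℝ} (hA : A.IsSymm) :
    IsMoorePenroseInverse A (moorePenrose A) :=
  Classical.epsilon_spec (exists_isMoorePenroseInverse hA)

end MoorePenrose

section Markov

variable {V : Type*} [Fintype V]

open Classical in
/-- For a chain with transition matrix `P` started at `i`, the probability that the first visit to
`j` after time `0` takes place at time `n` (for `n ≥ 1`): the sum, over all trajectories
`i = x₀, x₁, …, xₙ = j` which avoid `j` at the times strictly between `0` and `n`, of the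
probability `∏ P (x_l) (x_{l+1})` of the trajectory. -/
def firstPassageProb (P : Matrix V V ℝ) (i j : V) (n : ℕ) : ℝ :=
  ∑ x : Fin (n + 1) → V with
      x 0 = i ∧ x (Fin.last n) = j ∧ ∀ l, 0 < l → l < Fin.last n → x l ≠ j,
    ∏ l : Fin n, P (x l.castSucc) (x l.succ)

/-- Mean first passage time from `i` to `j`: the expectation of the first passage time. -/
def meanFirstPassageTime (P : Matrix V V ℝ) (i j : V) : ℝ :=
  ∑' n : ℕ, (n : ℝ) * firstPassageProb P i j n

open Classical in
/-- Kemeny's constant `∑ᵢ ∑_{j ≠ i} πᵢ mᵢⱼ πⱼ` of a chain with transition matrix `P` and stationary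
distribution `π`. -/
def kemenyOfChain (P : Matrix V V ℝ) (π : V → ℝ) : ℝ :=
  ∑ i, ∑ j with j ≠ i, π i * meanFirstPassageTime P i j * π j

end Markov

section Graph

variable {V : Type*} [Fintype V] (G : SimpleGraph V)

/-- Number of edges `m_G`. -/
def numEdges {V : Type*} (G : SimpleGraph V) : ℕ := G.edgeSet.ncard

open Classical in
/-- The degree vector `d_G`. -/
def degVec : V → ℝ := fun v => (G.degree v : ℝ)

open Classical in
/-- Transition matrix of the simple random walk on `G`. -/
def walkMatrix : Matrix V V ℝ :=
  Matrix.of fun u v => if G.Adj u v then 1 / (G.degree u : ℝ) else 0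

/-- Stationary distribution `d_G / (2 m_G)` of the simple random walk on a connected graph. -/
def stationary : V → ℝ := fun v => degVec G v / (2 * numEdges G)

/-- `stationary G` is invariant under the walk. -/
theorem stationary_vecMul : stationary G ᵥ* walkMatrix G = stationary G := by
  classical
  ext v
  have h : ∀ u, stationary G u * walkMatrix G u v
      = if G.Adj v u then 1 / (2 * (numEdges G : ℝ)) else 0 := by
    intro u
    by_cases huv : G.Adj u v
    · have hd : (G.degree u : ℝ) ≠ 0 := by
        have : 0 < G.degree u := (G.degree_pos_iff_exists_adj u).2 ⟨v, huv⟩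
        exact_mod_cast this.ne'
      simp only [stationary, walkMatrix, degVec, Matrix.of_apply, huv, huv.symm, if_true]
      convert (by field_simp : (G.degree u : ℝ) / (2 * (numEdges G : ℝ)) * (1 / (G.degree u : ℝ))
        = 1 / (2 * (numEdges G : ℝ)))
    · have hvu : ¬ G.Adj v u := fun h => huv h.symm
      simp [walkMatrix, huv, hvu]
  simp only [Matrix.vecMul, dotProduct, h]
  rw [← Finset.sum_filter, Finset.sum_const, ← SimpleGraph.neighborFinset_eq_filter,
    SimpleGraph.card_neighborFinset_eq_degree, nsmul_eq_mul]
  simp only [stationary, degVec, mul_one_div]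

/-- The entries of `stationary G` sum to one as soon as `G` has an edge. -/
theorem stationary_sum (h : numEdges G ≠ 0) : ∑ v, stationary G v = 1 := by
  classical
  have h2 : ∑ v, degVec G v = 2 * (numEdges G : ℝ) := by
    have := G.sum_degrees_eq_twice_card_edges
    rw [numEdges, ← SimpleGraph.coe_edgeFinset, Set.ncard_coe_finset]
    simp only [degVec]
    convert (by exact_mod_cast this :
      ∑ v, (G.degree v : ℝ) = 2 * (G.edgeFinset.card : ℝ))
  simp only [stationary]
  rw [← Finset.sum_div, h2, div_self]
  exact mul_ne_zero two_ne_zero (Nat.cast_ne_zero.2 h)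

/-- Kemeny's constant `κ(G)` of the simple random walk on `G`. -/
def kemeny : ℝ := kemenyOfChain (walkMatrix G) (stationary G)

open Classical in
/-- Effective resistance `(e_u - e_v)ᵀ L† (e_u - e_v)`, `L` the Laplacian matrix of `G`. -/
def resistance (u v : V) : ℝ :=
  (Pi.single u 1 - Pi.single v 1) ⬝ᵥ
    (moorePenrose (G.lapMatrix ℝ) *ᵥ (Pi.single u 1 - Pi.single v 1))

/-- The effective resistance matrix `R_G`. -/
def resistanceMatrix : Matrix V V ℝ := Matrix.of (resistance G)

open Classical in
/-- The moment `d_Gᵀ R_G e_v`. -/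
def moment (v : V) : ℝ := degVec G ⬝ᵥ (resistanceMatrix G *ᵥ Pi.single v 1)

end Graph

section Chain

variable {k : ℕ} (T : SimpleGraph (Fin k)) {V : Fin k → Type*}
  (H : ∀ i, SimpleGraph (V i)) (c : ∀ i, T.neighborSet i → V i)

/-- The chain of the graphs `H i` with respect to `T`: the disjoint union of the `H i`, with, for
each edge `{i, j}` of `T`, one additional edge between the chosen vertex `c i j` of `H i` and
the chosen vertex `c j i` of `H j`. -/
def chainGraph : SimpleGraph (Σ i, V i) where
  Adj x y := (∃ (i : Fin k) (a b : V i), (H i).Adj a b ∧ x = ⟨i, a⟩ ∧ y = ⟨i, b⟩) ∨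
    (∃ (i j : Fin k) (h : T.Adj i j), x = ⟨i, c i ⟨j, h⟩⟩ ∧ y = ⟨j, c j ⟨i, h.symm⟩⟩)
  symm := ⟨by
    rintro x y (⟨i, a, b, h, rfl, rfl⟩ | ⟨i, j, h, rfl, rfl⟩)
    · exact Or.inl ⟨i, b, a, h.symm, rfl, rfl⟩
    · exact Or.inr ⟨j, i, h.symm, rfl, rfl⟩⟩
  loopless := ⟨by
    rintro x (⟨i, a, b, h, rfl, h2⟩ | ⟨i, j, h, rfl, h2⟩)
    · obtain rfl : a = b := by simpa using h2
      exact h.ne rfl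
    · exact h.ne (congrArg Sigma.fst h2)⟩

/-- The number of edges of the component containing `x` of the graph `G` with the edge `{x, y}`
deleted. -/
def edgesOnSide {U : Type*} (G : SimpleGraph U) (x y : U) : ℕ :=
  numEdges ((G.deleteEdges {s(x, y)}).connectedComponentMk x).toSimpleGraph

/-- `W_x`, for the bridge `x ∼ y` corresponding to the edge `{i, j}` of `T`, with `x` in `H i`. -/
def bridgeW (i : Fin k) (j : T.neighborSet i) : ℕ :=
  edgesOnSide (chainGraph T H c) ⟨i, c i j⟩ ⟨j, c j ⟨i, j.2.symm⟩⟩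

/-- `m_G - W_x`, for the bridge `x ∼ y` corresponding to the edge `{i, j}` of `T`, with `x` in
`H i`. -/
def bridgeWbar (i : Fin k) (j : T.neighborSet i) : ℝ :=
  (numEdges (chainGraph T H c) : ℝ) - bridgeW T H c i j

/-- The edges of `T`, each listed once, with the smaller end vertex first. They index the set of
bridges of the chain. -/
abbrev TreeEdge := {p : Fin k × Fin k // p.1 < p.2 ∧ T.Adj p.1 p.2}

variable {T}

/-- The first end vertex of an edge of `T`. -/
abbrev TreeEdge.i (e : TreeEdge T) : Fin k := e.1.1

/-- The second end vertex of an edge of `T`. -/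
abbrev TreeEdge.j (e : TreeEdge T) : Fin k := e.1.2

/-- The second end vertex of an edge of `T` as a neighbour of the first. -/
abbrev TreeEdge.toJ (e : TreeEdge T) : T.neighborSet e.i := ⟨e.j, e.2.2⟩

/-- The first end vertex of an edge of `T` as a neighbour of the second. -/
abbrev TreeEdge.toI (e : TreeEdge T) : T.neighborSet e.j := ⟨e.i, e.2.2.symm⟩

end Chain

end KemenyChain

end

open KemenyChain

/-! Kemeny's constant is a quadratic form in effective resistances: `4 m κ(G) = ∑ d_u d_v r_{u,v}`
(`four_mul_numEdges_mul_kemeny`). It comes from writing mean first passage times through `L†`, the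
candidate being recognised as a nonnegative solution of the one-step equations.

In a chain, current from `x` to `y` crosses exactly the bridges separating them, and inside the
block `l` it flows between the projections `p_l x` and `p_l y`. Hence `r_{x,y} = ∑_l r^l(p_l x, p_l
y) + dist_T` (`resistance_chainGraph`). The proof is not electrical: a symmetric matrix with zero
diagonal whose columns have the right Laplacians is the resistance matrix (`eq_resistance`), and the
right-hand side is checked to be one.

It remains to sum against the degrees. The far side of a bridge has degree sum `2 W̄ - 1`, and the
half of the bridge at its near end adds `1`, so the degree measure of the chain pushed forward by
`p_i` is `d_{G_i} + 2 ∑_z W̄_{i,z} δ_{c_{i,z}}` (`sum_degVec_mul_apply_chainProj`). Expanding the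
quadratic form of this measure gives the Kemeny, moment and double-sum terms; the tree distance
counts separating bridges and gives the products `(2 W̄ - 1)(2 W̄' - 1)`. Division by `4 m`
finishes. -/

namespace KemenyChain

/-! ### First passage times from one-step equations -/

section Markov

variable {V : Type*} [Fintype V]

open Classical in
/-- The transition matrix `P` killed upon entering `j`. -/
noncomputable def killedMatrix (P : Matrix V V ℝ) (j : V) : Matrix V V ℝ :=
  Matrix.of fun u w => if w = j then 0 else P u w

theorem firstPassageProb_one (P : Matrix V V ℝ) (i j : V) : firstPassageProb P i j 1 = P i j := by
  classical
  unfold firstPassageProb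
  have hs : (Finset.univ.filter fun x : Fin 2 → V => x 0 = i ∧ x (Fin.last 1) = j ∧
      ∀ l, 0 < l → l < Fin.last 1 → x l ≠ j) = {![i, j]} := by
    ext x
    simp only [Finset.mem_filter, Finset.mem_univ, true_and, Finset.mem_singleton]
    constructor
    · rintro ⟨h0, h1, -⟩
      ext l
      fin_cases l
      · exact h0
      · exact h1
    · rintro rfl
      refine ⟨rfl, rfl, fun l h0 h1 => ?_⟩
      simp only [Fin.lt_def, Fin.val_zero, Fin.val_last] at h0 h1
      omega
  convert Finset.sum_singleton (fun x : Fin 2 → V => ∏ l : Fin 1, P (x l.castSucc) (x l.succ))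
    ![i, j] using 1
  · exact Finset.sum_congr (by convert hs) fun _ _ => rfl
  · simp

/-- Conditioning on the first step. With at least two steps, the position after the first one is
intermediate and must avoid `j`, so that step is taken with the killed matrix. -/
theorem firstPassageProb_succ (P : Matrix V V ℝ) (i j : V) (n : ℕ) :
    firstPassageProb P i j (n + 2) =
      (killedMatrix P j *ᵥ fun w => firstPassageProb P w j (n + 1)) i := by
  classical
  have hcond : ∀ (v : V) (y : Fin (n + 2) → V),
      ((Fin.cons v y : Fin (n + 3) → V) 0 = i ∧
        (Fin.cons v y : Fin (n + 3) → V) (Fin.last (n + 2)) = j ∧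
        ∀ l, 0 < l → l < Fin.last (n + 2) → (Fin.cons v y : Fin (n + 3) → V) l ≠ j) ↔
      v = i ∧ y 0 ≠ j ∧ (y (Fin.last (n + 1)) = j ∧
        ∀ l, 0 < l → l < Fin.last (n + 1) → y l ≠ j) := by
    intro v y
    have h1 : (Fin.cons v y : Fin (n + 3) → V) (Fin.last (n + 2)) = y (Fin.last (n + 1)) := by
      rw [← Fin.succ_last, Fin.cons_succ]
    rw [h1, Fin.cons_zero]
    constructor
    · rintro ⟨h0, hl, h⟩
      have h' : ∀ l : Fin (n + 2), l < Fin.last (n + 1) → y l ≠ j := by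
        intro l hl
        have := h l.succ (Fin.succ_pos l) (by rw [← Fin.succ_last]; exact Fin.succ_lt_succ_iff.2 hl)
        rwa [Fin.cons_succ] at this
      exact ⟨h0, h' 0 (Fin.last_pos), hl, fun l _ h2 => h' l h2⟩
    · rintro ⟨h0, hy, hl, h⟩
      refine ⟨h0, hl, fun l h2 h3 => ?_⟩
      obtain ⟨l, rfl⟩ := Fin.exists_succ_eq.2 h2.ne'
      rw [Fin.cons_succ]
      rw [← Fin.succ_last, Fin.succ_lt_succ_iff] at h3
      rcases eq_or_ne l 0 with rfl | hl0
      · exact hy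
      · exact h l (Fin.pos_of_ne_zero hl0) h3
  have hL : firstPassageProb P i j (n + 2) = ∑ y : Fin (n + 2) → V,
      if y 0 ≠ j ∧ (y (Fin.last (n + 1)) = j ∧ ∀ l, 0 < l → l < Fin.last (n + 1) → y l ≠ j) then
        P i (y 0) * ∏ l : Fin (n + 1), P (y l.castSucc) (y l.succ) else 0 := by
    unfold firstPassageProb
    rw [Finset.sum_filter, ← (Fin.consEquiv (fun _ : Fin (n + 3) => V)).sum_comp,
      Fintype.sum_prod_type]
    rw [Finset.sum_eq_single i]
    · refine Finset.sum_congr rfl fun y _ => ?_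
      simp only [Fin.consEquiv_apply]
      refine if_congr ((hcond i y).trans (by simp)) ?_ rfl
      rw [Fin.prod_univ_succ]
      simp
    · intro v _ hv
      refine Finset.sum_eq_zero fun y _ => if_neg fun h => hv ((hcond v y).1 h).1
    · simp
  rw [hL]
  simp only [Matrix.mulVec, dotProduct, killedMatrix, Matrix.of_apply, firstPassageProb,
    Finset.sum_filter, Finset.mul_sum]
  rw [Finset.sum_comm]
  refine Finset.sum_congr rfl fun y _ => ?_
  rw [Finset.sum_eq_single (y 0)]
  · by_cases h : y 0 = j <;> simp [h]
  · intro w _ hw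
    simp [hw.symm]
  · simp

/-- A nonnegative solution `h` of the one-step equations is the mean first passage time. -/
theorem meanFirstPassageTime_eq {P : Matrix V V ℝ} (hP : ∀ u v, 0 ≤ P u v)
    (hP1 : ∀ u, ∑ v, P u v = 1) (j : V) {h : V → ℝ} (h0 : ∀ u, 0 ≤ h u)
    (hh : ∀ u, h u = 1 + (killedMatrix P j *ᵥ h) u) (i : V) :
    meanFirstPassageTime P i j = h i := by
  classical
  set Q := killedMatrix P j with hQ
  have hQ0 : ∀ u v, 0 ≤ Q u v := by
    intro u v
    simp only [hQ, killedMatrix, Matrix.of_apply]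
    split_ifs
    · exact le_rfl
    · exact hP u v
  have mono : ∀ f g : V → ℝ, (∀ u, f u ≤ g u) → ∀ u, (Q *ᵥ f) u ≤ (Q *ᵥ g) u := fun f g hfg u =>
    Finset.sum_le_sum fun w _ => mul_le_mul_of_nonneg_left (hfg w) (hQ0 u w)
  have nonneg : ∀ f : V → ℝ, (∀ u, 0 ≤ f u) → ∀ u, 0 ≤ (Q *ᵥ f) u := fun f hf u =>
    Finset.sum_nonneg fun w _ => mul_nonneg (hQ0 u w) (hf w)
  -- Survival probabilities: `a n u` is the chance of avoiding `j` at times `1, …, n` from `u`, and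
  -- its decrements are the first passage probabilities.
  set a : ℕ → V → ℝ := fun n => (Q.mulVec)^[n] 1 with ha
  have a0 : a 0 = 1 := rfl
  have as : ∀ n, a (n + 1) = Q *ᵥ a n := fun n => Function.iterate_succ_apply' _ _ _
  have h1 : ∀ u, 1 ≤ h u := fun u => by
    rw [hh u]; linarith [nonneg h h0 u]
  have hf : ∀ n u, firstPassageProb P u j (n + 1) = a n u - a (n + 1) u := by
    intro n
    induction n with
    | zero =>
      intro u
      rw [zero_add, firstPassageProb_one, as, a0]
      have : (Q *ᵥ 1) u = ∑ w, (P u w - if w = j then P u w else 0) := by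
        simp only [Matrix.mulVec, dotProduct, Pi.one_apply, mul_one, hQ, killedMatrix,
          Matrix.of_apply]
        refine Finset.sum_congr rfl fun w _ => ?_
        split_ifs <;> simp
      rw [this, Finset.sum_sub_distrib, hP1]
      simp
    | succ n ih =>
      intro u
      rw [firstPassageProb_succ, as (n + 1)]
      simp only [ih]
      have : (fun w => a n w - a (n + 1) w) = a n - a (n + 1) := rfl
      rw [this, Matrix.mulVec_sub, ← as n]
      rfl
  have an : ∀ n u, 0 ≤ a n u := by
    intro n
    induction n with
    | zero => intro u; rw [a0]; exact zero_le_one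
    | succ n ih => rw [as]; exact nonneg _ ih
  set M : ℝ := ∑ u, h u with hM
  have hMu : ∀ u, h u ≤ M := fun u => Finset.single_le_sum (fun v _ => h0 v) (Finset.mem_univ u)
  have hM1 : 1 ≤ M := (h1 i).trans (hMu i)
  have hMpos : 0 < M := by linarith
  -- Since `h ≤ M`, `Q h = h - 1 ≤ (1 - 1/M) h`. The solution itself thus yields geometric decay of
  -- `Qⁿ`, and irreducibility is not needed.
  set ρ : ℝ := 1 - 1 / M with hρ
  have hρ0 : 0 ≤ ρ := by
    rw [hρ, sub_nonneg, div_le_one hMpos]; exact hM1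
  have hρ1 : ρ < 1 := by
    have : 0 < 1 / M := by positivity
    linarith
  have step : ∀ u, (Q *ᵥ h) u ≤ ρ * h u := by
    intro u
    have : h u / M ≤ 1 := by rw [div_le_one hMpos]; exact hMu u
    have e : ρ * h u = h u - h u / M := by rw [hρ]; ring
    linarith [hh u]
  have geo : ∀ n u, a n u ≤ ρ ^ n * h u := by
    intro n
    induction n with
    | zero => intro u; simpa [a0] using h1 u
    | succ n ih =>
      intro u
      rw [as]
      calc (Q *ᵥ a n) u ≤ (Q *ᵥ (ρ ^ n • h)) u := mono _ _ ih u
        _ = ρ ^ n * (Q *ᵥ h) u := by rw [Matrix.mulVec_smul]; rfl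
        _ ≤ ρ ^ n * (ρ * h u) := by gcongr; exact step u
        _ = ρ ^ (n + 1) * h u := by ring
  have partial_h : ∀ n u, ∑ l ∈ Finset.range n, a l u = h u - ((Q.mulVec)^[n] h) u := by
    intro n
    induction n with
    | zero => intro u; simp
    | succ n ih =>
      intro u
      have e1 : ∀ u, (∑ l ∈ Finset.range (n + 1), a l) u = h u - ((Q.mulVec)^[n + 1] h) u := by
        intro u
        rw [Finset.sum_range_succ']
        have e2 : ∑ l ∈ Finset.range n, a (l + 1) = Q *ᵥ (h - (Q.mulVec)^[n] h) := by
          rw [← show (∑ l ∈ Finset.range n, a l) = h - (Q.mulVec)^[n] h from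
            funext fun u => by rw [Finset.sum_apply, ih]; rfl]
          rw [Matrix.mulVec_sum]
          exact Finset.sum_congr rfl fun l _ => as l
        rw [e2, Matrix.mulVec_sub, Function.iterate_succ_apply', a0]
        have := hh u
        simp only [Pi.add_apply, Pi.sub_apply, Pi.one_apply]
        linarith
      simpa using e1 u
  have rem : ∀ n u, 0 ≤ ((Q.mulVec)^[n] h) u ∧ ((Q.mulVec)^[n] h) u ≤ ρ ^ n * h u := by
    intro n
    induction n with
    | zero => intro u; simpa using h0 u
    | succ n ih =>
      intro u
      rw [Function.iterate_succ_apply']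
      refine ⟨nonneg _ (fun u => (ih u).1) u, ?_⟩
      calc (Q *ᵥ ((Q.mulVec)^[n] h)) u ≤ (Q *ᵥ (ρ ^ n • h)) u := mono _ _ (fun u => (ih u).2) u
        _ = ρ ^ n * (Q *ᵥ h) u := by rw [Matrix.mulVec_smul]; rfl
        _ ≤ ρ ^ n * (ρ * h u) := by gcongr; exact step u
        _ = ρ ^ (n + 1) * h u := by ring
  -- Summation by parts turns the partial expectation into `∑_{l<N} a l i - N a N i`; both
  -- remainders then tend to `0` geometrically.
  have psum : ∀ N : ℕ, ∑ n ∈ Finset.range (N + 1), (n : ℝ) * firstPassageProb P i j n =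
      h i - ((Q.mulVec)^[N] h) i - N * a N i := by
    intro N
    rw [← partial_h, Finset.sum_range_succ']
    simp only [Nat.cast_zero, zero_mul, add_zero]
    induction N with
    | zero => simp
    | succ N ih =>
      rw [Finset.sum_range_succ, Finset.sum_range_succ, ih, hf]
      push_cast
      ring
  have ρpow : Filter.Tendsto (fun n : ℕ => ρ ^ n * h i) Filter.atTop (nhds 0) := by
    simpa using (tendsto_pow_atTop_nhds_zero_of_lt_one hρ0 hρ1).mul_const (h i)
  have nρpow : Filter.Tendsto (fun n : ℕ => (n * ρ ^ n) * h i) Filter.atTop (nhds 0) := by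
    simpa using (tendsto_self_mul_const_pow_of_lt_one hρ0 hρ1).mul_const (h i)
  have t1 : Filter.Tendsto (fun n : ℕ => ((Q.mulVec)^[n] h) i) Filter.atTop (nhds 0) :=
    squeeze_zero (fun n => (rem n i).1) (fun n => (rem n i).2) ρpow
  have t2 : Filter.Tendsto (fun n : ℕ => n * a n i) Filter.atTop (nhds 0) := by
    refine squeeze_zero (fun n => mul_nonneg n.cast_nonneg (an n i)) (fun n => ?_) nρpow
    rw [mul_assoc]
    exact mul_le_mul_of_nonneg_left (geo n i) n.cast_nonneg
  have fnonneg : ∀ n : ℕ, 0 ≤ (n : ℝ) * firstPassageProb P i j n := fun n =>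
    mul_nonneg n.cast_nonneg
      (Finset.sum_nonneg fun x _ => Finset.prod_nonneg fun l _ => hP _ _)
  refine HasSum.tsum_eq ?_
  rw [hasSum_iff_tendsto_nat_of_nonneg fnonneg, ← Filter.tendsto_add_atTop_iff_nat 1]
  simp only [psum]
  simpa using (tendsto_const_nhds.sub t1).sub t2

end Markov

/-! ### Laplacian, effective resistance and Kemeny's constant -/

section Graph

variable {V : Type*} [Fintype V] (G : SimpleGraph V)

open Classical in
theorem degVec_eq_sum (v : V) : degVec G v = ∑ w, if G.Adj v w then 1 else 0 :=
  G.degree_eq_sum_if_adj v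

open Classical in
theorem sum_degVec : ∑ v, degVec G v = 2 * (numEdges G : ℝ) := by
  have := G.sum_degrees_eq_twice_card_edges
  rw [numEdges, ← SimpleGraph.coe_edgeFinset, Set.ncard_coe_finset]
  simp only [degVec]
  exact_mod_cast this

open Classical in
theorem lapMatrix_mulVec_eq_sum (f : V → ℝ) (v : V) :
    (G.lapMatrix ℝ *ᵥ f) v = ∑ w, if G.Adj v w then f v - f w else 0 := by
  rw [SimpleGraph.lapMatrix_mulVec_apply, SimpleGraph.degree_eq_sum_if_adj, Finset.sum_mul,
    SimpleGraph.neighborFinset_eq_filter, Finset.sum_filter, ← Finset.sum_sub_distrib]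
  refine Finset.sum_congr rfl fun w _ => ?_
  split_ifs <;> ring

open Classical in
theorem isMoorePenroseInverse_lapMatrix :
    IsMoorePenroseInverse (G.lapMatrix ℝ) (moorePenrose (G.lapMatrix ℝ)) :=
  isMoorePenroseInverse_moorePenrose (G.isSymm_lapMatrix (R := ℝ))

open Classical in
theorem moorePenrose_lapMatrix_transpose :
    (moorePenrose (G.lapMatrix ℝ))ᵀ = moorePenrose (G.lapMatrix ℝ) := by
  have h := isMoorePenroseInverse_lapMatrix G
  have hL : (G.lapMatrix ℝ)ᵀ = G.lapMatrix ℝ := G.isSymm_lapMatrix (R := ℝ)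
  refine IsMoorePenroseInverse.unique (A := G.lapMatrix ℝ) ⟨?_, ?_, ?_, ?_⟩ h
  · simpa [Matrix.transpose_mul, hL, Matrix.mul_assoc] using congrArg Matrix.transpose h.mul_mul_self
  · simpa [Matrix.transpose_mul, hL, Matrix.mul_assoc] using congrArg Matrix.transpose h.self_mul_mul
  · simpa [Matrix.transpose_mul, hL] using h.symm_right.symm
  · simpa [Matrix.transpose_mul, hL] using h.symm_left.symm

open Classical in
theorem moorePenrose_lapMatrix_comm (u v : V) :
    moorePenrose (G.lapMatrix ℝ) u v = moorePenrose (G.lapMatrix ℝ) v u := by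
  conv_lhs => rw [← moorePenrose_lapMatrix_transpose]
  rfl

open Classical in
theorem resistance_eq (u v : V) :
    resistance G u v = moorePenrose (G.lapMatrix ℝ) u u + moorePenrose (G.lapMatrix ℝ) v v
      - 2 * moorePenrose (G.lapMatrix ℝ) u v := by
  have h := moorePenrose_lapMatrix_comm G v u
  simp only [resistance, Matrix.mulVec_sub, sub_dotProduct, dotProduct_sub, single_one_dotProduct,
    Matrix.mulVec_single_one, Matrix.col_apply]
  linarith

theorem resistance_comm (u v : V) : resistance G u v = resistance G v u := by
  rw [resistance_eq, resistance_eq, moorePenrose_lapMatrix_comm G u v]; ring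

theorem resistance_self (u : V) : resistance G u u = 0 := by
  rw [resistance_eq]; ring

variable {G}

open Classical in
theorem eq_of_lapMatrix_mulVec_eq_zero (hG : G.Connected) {f : V → ℝ}
    (hf : G.lapMatrix ℝ *ᵥ f = 0) (u v : V) : f u = f v :=
  G.lapMatrix_mulVec_eq_zero_iff_forall_reachable.1 hf u v (hG.preconnected u v)

open Classical in
/-- The Laplacian of a connected graph is inverted by its Moore–Penrose inverse on vectors with
zero sum. -/
theorem lapMatrix_mulVec_moorePenrose_mulVec (hG : G.Connected) {b : V → ℝ} (hb : ∑ v, b v = 0) :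
    G.lapMatrix ℝ *ᵥ (moorePenrose (G.lapMatrix ℝ) *ᵥ b) = b := by
  have h := isMoorePenroseInverse_lapMatrix G
  set L := G.lapMatrix ℝ with hL
  set X := moorePenrose L
  have hLs : Lᵀ = L := G.isSymm_lapMatrix (R := ℝ)
  -- `E` is symmetric and `L E = 0`, so by connectedness its columns, hence all its entries, are
  -- constant; it therefore kills zero-sum vectors.
  set E : Matrix V V ℝ := 1 - L * X with hE
  have hEs : Eᵀ = E := by rw [hE, Matrix.transpose_sub, Matrix.transpose_one, h.symm_left]
  have hEL : E * L = 0 := by rw [hE, sub_mul, h.mul_mul_self, one_mul, sub_self]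
  have hLE : L * E = 0 := by
    have := congrArg Matrix.transpose hEL
    rwa [Matrix.transpose_mul, hEs, hLs, Matrix.transpose_zero] at this
  have hcol : ∀ u u' v, E u v = E u' v := by
    intro u u' v
    refine eq_of_lapMatrix_mulVec_eq_zero hG (f := fun w => E w v) ?_ u u'
    ext w
    exact congrFun (congrFun hLE w) v
  have hEb : E *ᵥ b = 0 := by
    ext u
    have : ∀ v, E u v = E u u := fun v => by
      calc E u v = Eᵀ v u := rfl
        _ = E v u := by rw [hEs]
        _ = E u u := hcol _ _ _
    simp only [Matrix.mulVec, dotProduct, this, ← Finset.mul_sum, hb, mul_zero, Pi.zero_apply]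
  rw [hE, Matrix.sub_mulVec, Matrix.one_mulVec, sub_eq_zero, ← Matrix.mulVec_mulVec] at hEb
  exact hEb.symm

-- In the difference of two columns the term `X z z` cancels; what is left is a constant plus `2 X
-- (e_{y'} - e_y)`, and `L X` fixes zero-sum vectors.
open Classical in
theorem lapMatrix_mulVec_resistance_sub (hG : G.Connected) (y y' : V) :
    G.lapMatrix ℝ *ᵥ (fun z => resistance G z y - resistance G z y') =
      (2 : ℝ) • (Pi.single y' 1 - Pi.single y 1) := by
  set X := moorePenrose (G.lapMatrix ℝ) with hX
  have e : (fun z => resistance G z y - resistance G z y') =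
      (X y y - X y' y') • (fun _ => (1 : ℝ)) +
        (2 : ℝ) • (X *ᵥ (Pi.single y' 1 - Pi.single y 1)) := by
    ext z
    simp only [resistance_eq, Matrix.mulVec_sub, Matrix.mulVec_single_one, Pi.add_apply,
      Pi.smul_apply, Pi.sub_apply, Matrix.col_apply, smul_eq_mul, ← hX]
    ring
  rw [e, Matrix.mulVec_add, Matrix.mulVec_smul, Matrix.mulVec_smul,
    lapMatrix_mulVec_moorePenrose_mulVec hG (by simp), SimpleGraph.lapMatrix_mulVec_const_eq_zero]
  simp

/-- The Laplacian of the columns of the resistance matrix. -/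
theorem exists_sum_resistance_sub (hG : G.Connected) : ∃ τ : V → ℝ, ∀ a y,
    (open Classical in ∑ b, if G.Adj a b then resistance G a y - resistance G b y else 0) =
      τ a - (open Classical in if y = a then 2 else 0) := by
  classical
  obtain ⟨o⟩ := hG.nonempty
  refine ⟨fun a => (G.lapMatrix ℝ *ᵥ fun z => resistance G z o) a + if o = a then 2 else 0, ?_⟩
  intro a y
  have h := congrFun (lapMatrix_mulVec_resistance_sub hG y o) a
  have e : (fun z => resistance G z y - resistance G z o) =
    (fun z => resistance G z y) - fun z => resistance G z o := rfl
  rw [e, Matrix.mulVec_sub] at h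
  have h2 := lapMatrix_mulVec_eq_sum G (fun z => resistance G z y) a
  simp only [Pi.sub_apply, Pi.smul_apply, smul_eq_mul, Pi.single_apply, @eq_comm _ a] at h
  calc _ = (G.lapMatrix ℝ *ᵥ fun z => resistance G z y) a := by
        rw [h2]
    _ = _ := by
        beta_reduce
        split_ifs at h ⊢ <;> linarith

/-- A symmetric matrix with zero diagonal whose columns have, up to a common summand, the same
Laplacians as those of the resistance matrix is the resistance matrix. -/
theorem eq_resistance (hG : G.Connected) {D : V → V → ℝ} (hsymm : ∀ x y, D x y = D y x)
    (hdiag : ∀ x, D x x = 0) (τ : V → ℝ)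
    (hD : ∀ a y, (open Classical in ∑ b, if G.Adj a b then D a y - D b y else 0) =
      τ a - (open Classical in if y = a then 2 else 0)) (x y : V) : D x y = resistance G x y := by
  classical
  obtain ⟨σ, hσ⟩ := exists_sum_resistance_sub hG
  set E : V → V → ℝ := fun x y => D x y - resistance G x y with hE
  -- The unknown `τ` and `σ` drop out of differences of columns, which are therefore harmonic and
  -- constant. Symmetry and the zero diagonal then force `E = 0`.
  have key : ∀ z z' y y', E z y - E z y' = E z' y - E z' y' := by
    intro z z' y y'
    refine eq_of_lapMatrix_mulVec_eq_zero hG (f := fun z => E z y - E z y') ?_ z z'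
    ext a
    have h1 := hD a y
    have h2 := hD a y'
    have h3 := hσ a y
    have h4 := hσ a y'
    rw [lapMatrix_mulVec_eq_sum]
    have : (∑ w, if G.Adj a w then E a y - E a y' - (E w y - E w y') else 0) =
        (∑ b, if G.Adj a b then D a y - D b y else 0)
        - (∑ b, if G.Adj a b then D a y' - D b y' else 0)
        - (∑ b, if G.Adj a b then resistance G a y - resistance G b y else 0)
        + (∑ b, if G.Adj a b then resistance G a y' - resistance G b y' else 0) := by
      rw [← Finset.sum_sub_distrib, ← Finset.sum_sub_distrib, ← Finset.sum_add_distrib]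
      refine Finset.sum_congr rfl fun w _ => ?_
      split_ifs
      · simp only [hE]; ring
      · ring
    rw [this, h1, h2, h3, h4]
    simp
  have h := key x y x y
  have e1 : E x x = 0 := by simp [hE, hdiag, resistance_self]
  have e2 : E y y = 0 := by simp [hE, hdiag, resistance_self]
  have e3 : E y x = E x y := by simp only [hE]; rw [hsymm, resistance_comm]
  have : E x y = 0 := by linarith
  simpa [hE, sub_eq_zero] using this

open Classical in
/-- The mean first passage time of the simple random walk in terms of the Moore–Penrose inverse
of the Laplacian. -/
theorem meanFirstPassageTime_walkMatrix (hG : G.Connected) (hd : ∀ v, 0 < degVec G v) {u v : V}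
    (huv : v ≠ u) :
    meanFirstPassageTime (walkMatrix G) u v =
      (moorePenrose (G.lapMatrix ℝ) *ᵥ degVec G) u - (moorePenrose (G.lapMatrix ℝ) *ᵥ degVec G) v
      - 2 * numEdges G * moorePenrose (G.lapMatrix ℝ) u v
      + 2 * numEdges G * moorePenrose (G.lapMatrix ℝ) v v := by
  set X := moorePenrose (G.lapMatrix ℝ) with hX
  set m : ℝ := (numEdges G : ℝ) with hm
  -- The solution of `L g = d - 2 m e_v` normalised by `g v = 0`; the right-hand side has zero sum.
  set g : V → ℝ := fun u => (X *ᵥ degVec G) u - (X *ᵥ degVec G) v - 2 * m * X u v + 2 * m * X v v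
    with hg
  have gv : g v = 0 := by simp only [hg]; ring
  have hLg : ∀ w, w ≠ v → ∑ z, (if G.Adj w z then g w - g z else 0) = degVec G w := by
    intro w hw
    rw [← lapMatrix_mulVec_eq_sum]
    have e : g = X *ᵥ (degVec G - (2 * m) • Pi.single v 1) +
        (2 * m * X v v - (X *ᵥ degVec G) v) • (fun _ => (1 : ℝ)) := by
      ext z
      simp only [hg, Matrix.mulVec_sub, Matrix.mulVec_smul, Matrix.mulVec_single_one, Pi.add_apply,
        Pi.smul_apply, Pi.sub_apply, Matrix.col_apply, smul_eq_mul]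
      ring
    rw [e, Matrix.mulVec_add, Matrix.mulVec_smul, SimpleGraph.lapMatrix_mulVec_const_eq_zero,
      lapMatrix_mulVec_moorePenrose_mulVec hG]
    · simp [hw]
    · simp only [Pi.sub_apply, Pi.smul_apply, smul_eq_mul, Finset.sum_sub_distrib, sum_degVec,
        ← Finset.mul_sum, Finset.sum_pi_single', Finset.mem_univ, if_true]
      simp [hm]
  -- Minimum principle: at a minimiser other than `v` the Laplacian would be `≤ 0`, yet it equals a
  -- positive degree.
  have gnonneg : ∀ w, 0 ≤ g w := by
    obtain ⟨w, -, hw⟩ := Finset.exists_min_image Finset.univ g ⟨v, Finset.mem_univ v⟩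
    have : w = v := by
      by_contra hne
      have h1 := hLg w hne
      have h2 : ∑ z, (if G.Adj w z then g w - g z else 0) ≤ 0 := by
        refine Finset.sum_nonpos fun z _ => ?_
        split_ifs
        · linarith [hw z (Finset.mem_univ z)]
        · exact le_rfl
      linarith [hd w]
    subst this
    intro z
    rw [← gv]; exact hw z (Finset.mem_univ z)
  have hdeg : ∀ w, (G.degree w : ℝ) = degVec G w := fun w => rfl
  have hPnn : ∀ w z, 0 ≤ walkMatrix G w z := by
    intro w z
    simp only [walkMatrix, Matrix.of_apply]
    split_ifs
    · positivity
    · exact le_rfl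
  have hPf : ∀ (f : V → ℝ) w, ∑ z, walkMatrix G w z * f z =
      (∑ z, if G.Adj w z then f z else 0) / degVec G w := by
    intro f w
    rw [Finset.sum_div]
    refine Finset.sum_congr rfl fun z _ => ?_
    simp only [walkMatrix, Matrix.of_apply, hdeg]
    split_ifs <;> ring
  have hP1 : ∀ w, ∑ z, walkMatrix G w z = 1 := by
    intro w
    have := hPf (fun _ => 1) w
    simp only [mul_one] at this
    rw [this, ← degVec_eq_sum, div_self (hd w).ne']
  have hQ : ∀ (f : V → ℝ) w, (killedMatrix (walkMatrix G) v *ᵥ f) w =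
      ∑ z, walkMatrix G w z * (if z = v then 0 else f z) := by
    intro f w
    refine Finset.sum_congr rfl fun z _ => ?_
    simp only [killedMatrix, Matrix.of_apply]
    split_ifs <;> simp
  have hQg : ∀ w, (killedMatrix (walkMatrix G) v *ᵥ g) w = ∑ z, walkMatrix G w z * g z := by
    intro w
    rw [hQ]
    refine Finset.sum_congr rfl fun z _ => ?_
    split_ifs with h
    · rw [h, gv]
    · rfl
  have hgeq : ∀ w, w ≠ v → g w = 1 + (killedMatrix (walkMatrix G) v *ᵥ g) w := by
    intro w hw
    have h1 := hLg w hw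
    have h2 : ∑ z, (if G.Adj w z then g w - g z else 0) =
        degVec G w * g w - ∑ z, if G.Adj w z then g z else 0 := by
      rw [degVec_eq_sum, Finset.sum_mul, ← Finset.sum_sub_distrib]
      refine Finset.sum_congr rfl fun z _ => ?_
      split_ifs <;> ring
    rw [hQg, hPf]
    have := (hd w).ne'
    field_simp
    linarith
  -- `g` violates the one-step equation at `v` only, where it is `0`. `h` corrects that value to the
  -- mean return time; the killed matrix does not see it.
  set h : V → ℝ := fun w => 1 + (killedMatrix (walkMatrix G) v *ᵥ g) w with hh
  have hQh : ∀ w, (killedMatrix (walkMatrix G) v *ᵥ h) w =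
      (killedMatrix (walkMatrix G) v *ᵥ g) w := by
    intro w
    rw [hQ, hQ]
    refine Finset.sum_congr rfl fun z _ => ?_
    split_ifs with hz
    · rfl
    · rw [hgeq z hz]
  have hnn : ∀ w, 0 ≤ h w := by
    intro w
    simp only [hh, hQg]
    have := Finset.sum_nonneg fun z (_ : z ∈ Finset.univ) => mul_nonneg (hPnn w z) (gnonneg z)
    linarith
  rw [meanFirstPassageTime_eq hPnn hP1 v hnn (fun w => by rw [hQh]) u, hh]
  simp only
  rw [← hgeq u huv.symm]

theorem degVec_pos (hG : G.Connected) (hm : numEdges G ≠ 0) (v : V) : 0 < degVec G v := by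
  classical
  have : Nontrivial V := by
    by_contra hn
    rw [not_nontrivial_iff_subsingleton] at hn
    refine hm ?_
    have : G = ⊥ := by
      ext a b
      simp only [SimpleGraph.bot_adj, iff_false]
      exact fun h => h.ne (Subsingleton.elim a b)
    simp [numEdges, this]
  have := hG.preconnected.degree_pos_of_nontrivial v
  simpa [degVec] using this

/-- Kemeny's constant in terms of effective resistances. -/
theorem four_mul_numEdges_mul_kemeny (hG : G.Connected) :
    4 * (numEdges G : ℝ) * kemeny G = ∑ u, ∑ v, degVec G u * degVec G v * resistance G u v := by
  classical
  by_cases hm : numEdges G = 0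
  · have h0 : ∀ v, degVec G v = 0 := by
      have h := sum_degVec G
      rw [hm, Nat.cast_zero, mul_zero,
        Finset.sum_eq_zero_iff_of_nonneg fun v _ => by simp [degVec]] at h
      exact fun v => h v (Finset.mem_univ v)
    simp [hm, h0]
  have hm' : (numEdges G : ℝ) ≠ 0 := Nat.cast_ne_zero.2 hm
  have hd := degVec_pos hG hm
  set X := moorePenrose (G.lapMatrix ℝ) with hX
  set m : ℝ := (numEdges G : ℝ) with hmdef
  set d := degVec G with hddef
  set y := X *ᵥ d with hy
  have hsum : ∑ v, d v = 2 * m := sum_degVec G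
  -- The formula vanishes for `u = v`, so the diagonal may be included. The two sums with `y` will
  -- cancel.
  have hk : 4 * m * kemeny G = (1 / m) *
      ∑ u, ∑ v, d u * d v * (y u - y v - 2 * m * X u v + 2 * m * X v v) := by
    simp only [kemeny, kemenyOfChain, Finset.mul_sum]
    refine Finset.sum_congr rfl fun u _ => ?_
    rw [Finset.sum_filter]
    refine Finset.sum_congr rfl fun v _ => ?_
    split_ifs with h
    · rw [meanFirstPassageTime_walkMatrix hG hd h]
      simp only [stationary, ← hX, ← hmdef, ← hddef, ← hy]
      field_simp
      ring
    · obtain rfl : v = u := not_not.1 h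
      ring
  have hyu : ∀ u, ∑ v, X u v * d v = y u := fun u => rfl
  set q := ∑ u, d u * y u with hq
  set t := ∑ u, d u * X u u with ht
  have s1 : ∑ u, ∑ v, d u * d v * y u = 2 * m * q := by
    rw [← hsum, hq, Finset.sum_mul_sum, Finset.sum_comm]
    exact Finset.sum_congr rfl fun u _ => Finset.sum_congr rfl fun v _ => by ring
  have s2 : ∑ u, ∑ v, d u * d v * y v = 2 * m * q := by
    rw [← hsum, hq, Finset.sum_mul_sum]
    exact Finset.sum_congr rfl fun u _ => Finset.sum_congr rfl fun v _ => by ring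
  have s3 : ∑ u, ∑ v, d u * d v * X u v = q := by
    refine Finset.sum_congr rfl fun u _ => ?_
    rw [← hyu, Finset.mul_sum]
    exact Finset.sum_congr rfl fun v _ => by ring
  have s4 : ∑ u, ∑ v, d u * d v * X v v = 2 * m * t := by
    rw [← hsum, ht, Finset.sum_mul_sum]
    exact Finset.sum_congr rfl fun u _ => Finset.sum_congr rfl fun v _ => by ring
  have s5 : ∑ u, ∑ v, d u * d v * X u u = 2 * m * t := by
    rw [← hsum, ht, Finset.sum_mul_sum, Finset.sum_comm]
    exact Finset.sum_congr rfl fun u _ => Finset.sum_congr rfl fun v _ => by ring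
  have e1 : ∑ u, ∑ v, d u * d v * (y u - y v - 2 * m * X u v + 2 * m * X v v) =
      ∑ u, ∑ v, d u * d v * y u - ∑ u, ∑ v, d u * d v * y v
      - 2 * m * ∑ u, ∑ v, d u * d v * X u v + 2 * m * ∑ u, ∑ v, d u * d v * X v v := by
    simp only [Finset.mul_sum, ← Finset.sum_sub_distrib, ← Finset.sum_add_distrib]
    exact Finset.sum_congr rfl fun u _ => Finset.sum_congr rfl fun v _ => by ring
  have e2 : ∑ u, ∑ v, d u * d v * resistance G u v =
      ∑ u, ∑ v, d u * d v * X u u + ∑ u, ∑ v, d u * d v * X v v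
      - 2 * ∑ u, ∑ v, d u * d v * X u v := by
    simp only [Finset.mul_sum, ← Finset.sum_sub_distrib, ← Finset.sum_add_distrib, resistance_eq]
    exact Finset.sum_congr rfl fun u _ => Finset.sum_congr rfl fun v _ => by ring
  rw [hk, e1, e2, s1, s2, s3, s4, s5]
  field_simp
  ring

end Graph

/-! ### The two sides of an edge of a tree -/

section Tree

variable {α : Type*} {T : SimpleGraph α}

/-- For an edge `i ∼ j` of a tree, the vertex `l` lies on the side of `j`. -/
def FarSide (T : SimpleGraph α) (i j l : α) : Prop := T.dist j l < T.dist i l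

theorem not_farSide_self (i j : α) : ¬ FarSide T i j i := by
  simp [FarSide]

theorem farSide_of_adj {i j : α} (h : T.Adj i j) : FarSide T i j j := by
  rw [FarSide, SimpleGraph.dist_self, SimpleGraph.dist_eq_one_iff_adj.2 h]
  exact zero_lt_one

theorem dist_eq_or (hT : T.IsTree) {i j : α} (h : T.Adj i j) (l : α) :
    T.dist i l = T.dist j l + 1 ∨ T.dist j l = T.dist i l + 1 := by
  simpa [SimpleGraph.dist_comm] using hT.dist_eq_dist_add_one_of_adj l h

theorem not_farSide_iff (hT : T.IsTree) {i j : α} (h : T.Adj i j) (l : α) :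
    ¬ FarSide T i j l ↔ FarSide T j i l := by
  have := dist_eq_or hT h l
  unfold FarSide
  omega

/-- Take the first step of a geodesic from `i` to `l`. -/
theorem exists_farSide (hT : T.IsTree) {i l : α} (h : l ≠ i) : ∃ j, T.Adj i j ∧ FarSide T i j l := by
  obtain ⟨p, hp⟩ := hT.connected.exists_walk_length_eq_dist i l
  cases p with
  | nil => exact absurd rfl h
  | cons hadj q =>
    refine ⟨_, hadj, ?_⟩
    have := SimpleGraph.dist_le q
    rw [SimpleGraph.Walk.length_cons] at hp
    unfold FarSide
    omega

/-- Each neighbour closer to `l` starts a geodesic from `i` to `l`, and paths in a tree are unique.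
-/
theorem farSide_unique (hT : T.IsTree) {i j j' l : α} (h : T.Adj i j) (h' : T.Adj i j')
    (hl : FarSide T i j l) (hl' : FarSide T i j' l) : j = j' := by
  have key : ∀ {s : α} (hs : T.Adj i s), FarSide T i s l →
      ∃ p : T.Walk s l, (SimpleGraph.Walk.cons hs p).IsPath := by
    intro s hs hsl
    obtain ⟨p, hp⟩ := hT.connected.exists_walk_length_eq_dist s l
    refine ⟨p, SimpleGraph.Walk.isPath_of_length_eq_dist _ ?_⟩
    rw [SimpleGraph.Walk.length_cons, hp]
    have := dist_eq_or hT hs l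
    unfold FarSide at hsl
    omega
  obtain ⟨p, hp⟩ := key h hl
  obtain ⟨p', hp'⟩ := key h' hl'
  have := congrArg Subtype.val 
    ((hT.isAcyclic.subsingleton_path i l).elim ⟨_, hp⟩ ⟨_, hp'⟩)
  simpa using congrArg SimpleGraph.Walk.snd this

theorem FarSide.of_adj (hT : T.IsTree) {i j l l' : α} (h : T.Adj i j) (hl : T.Adj l l')
    (hne : ¬ (l = j ∧ l' = i)) (hf : FarSide T i j l) : FarSide T i j l' := by
  by_contra hn
  rw [not_farSide_iff hT h] at hn
  have d1 := dist_eq_or hT h l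
  have d2 := dist_eq_or hT h l'
  have d3 := dist_eq_or hT hl i
  have d4 := dist_eq_or hT hl j
  simp only [FarSide, SimpleGraph.dist_comm (u := l), SimpleGraph.dist_comm (u := l')] at *
  by_cases hi : l' = i
  · subst hi
    rw [SimpleGraph.dist_self] at *
    have : T.dist j l = 0 := by omega
    exact hne ⟨((hT.connected.dist_eq_zero_iff).1 this).symm, rfl⟩
  -- Here `d(l, j) = d(l', i)`. The step from `l'` to `u` towards `i` also approaches `j`, as does
  -- the step to `l`; so `u = l`, although `l` is farther from `i` than `l'`.
  · obtain ⟨u, hu, hui⟩ := exists_farSide hT (i := l') (l := i) (Ne.symm hi)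
    have huj : FarSide T l' u j := by
      have e1 := hT.connected.dist_triangle (u := u) (v := i) (w := j)
      have e2 : T.dist i j = 1 := SimpleGraph.dist_eq_one_iff_adj.2 h
      unfold FarSide at hui ⊢
      rw [SimpleGraph.dist_comm (u := l') (v := i)] at hui
      rw [SimpleGraph.dist_comm (u := l') (v := j)]
      omega
    have hlj : FarSide T l' l j := by
      unfold FarSide
      rw [SimpleGraph.dist_comm (u := l') (v := j), SimpleGraph.dist_comm (u := l) (v := j)]
      omega
    obtain rfl := farSide_unique hT hu hl.symm huj hlj
    unfold FarSide at hui
    rw [SimpleGraph.dist_comm (u := l') (v := i), SimpleGraph.dist_comm (u := u) (v := i)] at hui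
    omega

/-- Only the edge `i ∼ j` itself joins the two sides of `i ∼ j`. -/
theorem farSide_congr (hT : T.IsTree) {i j l l' : α} (h : T.Adj i j) (hl : T.Adj l l')
    (h1 : ¬ (l = j ∧ l' = i)) (h2 : ¬ (l = i ∧ l' = j)) : FarSide T i j l ↔ FarSide T i j l' :=
  ⟨FarSide.of_adj hT h hl h1, FarSide.of_adj hT h hl.symm fun h3 => h2 h3.symm⟩

end Tree

/-! ### Sums over the edges of the tree -/

section TreeEdge

variable {k : ℕ} {T : SimpleGraph (Fin k)} [DecidableRel T.Adj]

/-- The distance in a tree counts the separating edges. -/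
theorem dist_eq_sum_treeEdge (hT : T.IsTree) (u v : Fin k) :
    (T.dist u v : ℝ) = ∑ e : TreeEdge T,
      (open Classical in if (FarSide T e.i e.j u ↔ FarSide T e.i e.j v) then 0 else 1) := by
  classical
  induction hn : T.dist u v generalizing u with
  | zero =>
    obtain rfl := (hT.connected.dist_eq_zero_iff).1 hn
    simp
  | succ n ih =>
    have hne : v ≠ u := by
      rintro rfl
      simp at hn
    obtain ⟨w, huw, hf⟩ := exists_farSide hT hne
    have hw : T.dist w v = n := by
      have := dist_eq_or hT huw v
      unfold FarSide at hf
      omega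
    -- Stepping from `u` to `w` changes only the summand of the edge `u ∼ w`, from `1` to `0`. The
    -- two cases below are its two possible orientations in `TreeEdge`.
    rw [Nat.cast_succ, ih w hw, eq_comm, ← sub_eq_iff_eq_add', ← Finset.sum_sub_distrib]
    rcases lt_or_gt_of_ne huw.ne with hlt | hlt
    · rw [Fintype.sum_eq_single (⟨(u, w), hlt, huw⟩ : TreeEdge T)]
      · simp [hf, not_farSide_self, farSide_of_adj huw]
      · rintro ⟨⟨a, b⟩, hab, hadj⟩ he
        have : FarSide T a b u ↔ FarSide T a b w := by
          refine farSide_congr hT hadj huw ?_ ?_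
          · rintro ⟨rfl, rfl⟩
            exact absurd hab hlt.not_gt
          · rintro ⟨rfl, rfl⟩
            exact he rfl
        simp only [this, sub_self]
    · have hf' : ¬ FarSide T w u v := (not_farSide_iff hT huw.symm v).2 hf
      rw [Fintype.sum_eq_single (⟨(w, u), hlt, huw.symm⟩ : TreeEdge T)]
      · simp [hf', not_farSide_self, farSide_of_adj huw.symm]
      · rintro ⟨⟨a, b⟩, hab, hadj⟩ he
        have : FarSide T a b u ↔ FarSide T a b w := by
          refine farSide_congr hT hadj huw ?_ ?_
          · rintro ⟨rfl, rfl⟩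
            exact he rfl
          · rintro ⟨rfl, rfl⟩
            exact absurd hab hlt.not_gt
        simp only [this, sub_self]

/-- Summing over the edges of `T` and their two orientations. -/
theorem sum_treeEdge_add (F : ∀ i, T.neighborSet i → ℝ) :
    ∑ e : TreeEdge T, (F e.i e.toJ + F e.j e.toI) = ∑ i, ∑ z : T.neighborSet i, F i z := by
  classical
  rw [show ∑ i, ∑ z : T.neighborSet i, F i z = ∑ p : (i : Fin k) × T.neighborSet i, F p.1 p.2 from
    (Fintype.sum_sigma fun p : (i : Fin k) × T.neighborSet i => F p.1 p.2).symm,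
    Finset.sum_add_distrib,
    ← Finset.sum_filter_add_sum_filter_not _
      (fun p : (i : Fin k) × T.neighborSet i => p.1 < p.2.1)]
  congr 1
  · refine Finset.sum_bij' (fun e _ => ⟨e.i, e.toJ⟩)
      (fun p hp => ⟨(p.1, p.2.1), (Finset.mem_filter.1 hp).2, p.2.2⟩) ?_ ?_ ?_ ?_ ?_
    · exact fun e _ => Finset.mem_filter.2 ⟨Finset.mem_univ _, e.2.1⟩
    all_goals simp
  · refine Finset.sum_bij' (fun e _ => ⟨e.j, e.toI⟩)
      (fun p hp => ⟨(p.2.1, p.1), lt_of_le_of_ne (not_lt.1 (Finset.mem_filter.1 hp).2)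
        (SimpleGraph.Adj.ne p.2.2).symm, SimpleGraph.Adj.symm p.2.2⟩) ?_ ?_ ?_ ?_ ?_
    · exact fun e _ => Finset.mem_filter.2 ⟨Finset.mem_univ _, e.2.1.not_gt⟩
    all_goals simp

theorem sum_neighborSet (i : Fin k) (F : T.neighborSet i → ℝ) :
    ∑ z : T.neighborSet i, F z = ∑ j, if h : T.Adj i j then F ⟨j, h⟩ else 0 := by
  classical
  rw [← Finset.sum_filter_of_ne (p := fun j => T.Adj i j),
    Finset.sum_subtype (p := fun j => j ∈ T.neighborSet i) _ (by simp)]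
  · exact Finset.sum_congr rfl fun z _ => by
      have hz : T.Adj i z := z.2
      rw [dif_pos hz]
  · intro j _ hj
    by_contra h
    exact hj (dif_neg h)

end TreeEdge

/-! ### Degree sums on one side of a bridge -/

section Sides

variable {V : Type*} [Fintype V] (G : SimpleGraph V)

open Classical in
theorem two_mul_numEdges_induce (S : Set V) :
    2 * (numEdges (G.induce S) : ℝ) =
      ∑ v, if v ∈ S then ∑ w, (if w ∈ S ∧ G.Adj v w then 1 else 0) else 0 := by
  have key : ∀ f : V → ℝ, ∑ v : S, f v = ∑ v, if v ∈ S then f v else 0 := by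
    intro f
    rw [← Finset.sum_filter, Finset.sum_subtype (p := fun v => v ∈ S) _ (by simp)]
  rw [← sum_degVec, ← key]
  refine Finset.sum_congr rfl fun v _ => ?_
  rw [degVec_eq_sum]
  simp only [ite_and]
  rw [← key]
  exact Finset.sum_congr rfl fun w _ => by simp

open Classical in
/-- If `x` and `y` are separated by deleting the edge between them, the degrees on the side of `x`
sum to twice the number of edges there plus one. -/
theorem sum_degVec_side {x y : V} (hxy : G.Adj x y) {S : Set V}
    (hS : ((G.deleteEdges {s(x, y)}).connectedComponentMk x).supp = S) (hy : y ∉ S) :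
    ∑ v, (if v ∈ S then degVec G v else 0) = 2 * (edgesOnSide G x y : ℝ) + 1 := by
  have hW : edgesOnSide G x y = numEdges ((G.deleteEdges {s(x, y)}).induce S) := by
    rw [← hS]
    rfl
  obtain ⟨G', hG'⟩ : ∃ G', G' = G.deleteEdges {s(x, y)} := ⟨_, rfl⟩
  rw [← hG'] at hS hW
  have hx : x ∈ S := hS ▸ rfl
  have hclosed : ∀ v w, v ∈ S → G'.Adj v w → w ∈ S := by
    rw [← hS]
    exact fun v w hv hvw => SimpleGraph.ConnectedComponent.mem_supp_of_adj_mem_supp _ hv hvw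
  rw [hW, two_mul_numEdges_induce, ← sub_eq_iff_eq_add', ← Finset.sum_sub_distrib]
  -- `S` is closed under adjacency in `G'`, so inside `S` the only loss of degree is that of `x`,
  -- through the deleted edge.
  have : ∀ v, ((if v ∈ S then degVec G v else 0) -
      if v ∈ S then ∑ w, (if w ∈ S ∧ G'.Adj v w then 1 else 0) else 0) =
      if v = x then (1 : ℝ) else 0 := by
    intro v
    by_cases hv : v ∈ S
    · have hvy : v ≠ y := fun h => hy (h ▸ hv)
      rw [if_pos hv, if_pos hv, degVec_eq_sum, ← Finset.sum_sub_distrib]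
      have e : ∀ w, ((if G.Adj v w then (1 : ℝ) else 0) - if w ∈ S ∧ G'.Adj v w then 1 else 0) =
          if w = y then (if v = x then 1 else 0) else 0 := by
        intro w
        have hw : w ∈ S ∧ G'.Adj v w ↔ G.Adj v w ∧ ¬ (v = x ∧ w = y) := by
          rw [and_iff_right_of_imp (hclosed v w hv),
            hG', SimpleGraph.deleteEdges_adj]
          simp [hvy]
        by_cases h1 : v = x ∧ w = y
        · obtain ⟨rfl, rfl⟩ := h1
          simp [hw, hxy]
        · have h2 : (if w = y then (if v = x then (1 : ℝ) else 0) else 0) = 0 := by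
            split_ifs with a b
            · exact absurd ⟨b, a⟩ h1
            · rfl
            · rfl
          rw [h2]
          simp only [hw, h1, not_false_eq_true, and_true, sub_self]
      simp only [e, Finset.sum_ite_eq', Finset.mem_univ, if_true]
    · have hvx : v ≠ x := by
        rintro rfl
        exact hv hx
      rw [if_neg hv, if_neg hv, if_neg hvx, sub_self]
  refine (Finset.sum_congr rfl fun v _ => this v).trans ?_
  simp only [Finset.sum_ite_eq', Finset.mem_univ, if_true]

end Sides

/-! ### Adjacency, connectedness and bridge sides of a chain -/

section Chain

variable {k : ℕ} {T : SimpleGraph (Fin k)} {V : Fin k → Type*}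
  {H : ∀ i, SimpleGraph (V i)} {c : ∀ i, T.neighborSet i → V i}

theorem chainGraph_adj_mk {i : Fin k} {a b : V i} :
    (chainGraph T H c).Adj ⟨i, a⟩ ⟨i, b⟩ ↔ (H i).Adj a b := by
  constructor
  · rintro (⟨l, a', b', h, h1, h2⟩ | ⟨l, l', h, h1, h2⟩)
    · obtain ⟨rfl, h1⟩ := Sigma.mk.inj h1
      obtain rfl := eq_of_heq h1
      obtain rfl := eq_of_heq (Sigma.mk.inj h2).2
      exact h
    · exact absurd ((Sigma.mk.inj h1).1.symm.trans (Sigma.mk.inj h2).1) h.ne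
  · exact fun h => Or.inl ⟨i, a, b, h, rfl, rfl⟩

theorem chainGraph_adj_of_ne {i j : Fin k} (hij : i ≠ j) {a : V i} {b : V j} :
    (chainGraph T H c).Adj ⟨i, a⟩ ⟨j, b⟩ ↔
      ∃ h : T.Adj i j, c i ⟨j, h⟩ = a ∧ c j ⟨i, h.symm⟩ = b := by
  constructor
  · rintro (⟨l, a', b', h, h1, h2⟩ | ⟨l, l', h, h1, h2⟩)
    · exact absurd ((Sigma.mk.inj h1).1.trans (Sigma.mk.inj h2).1.symm) hij
    · obtain ⟨rfl, h1⟩ := Sigma.mk.inj h1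
      obtain rfl := eq_of_heq h1
      obtain ⟨rfl, h2⟩ := Sigma.mk.inj h2
      obtain rfl := eq_of_heq h2
      exact ⟨h, rfl, rfl⟩
  · rintro ⟨h, rfl, rfl⟩
    exact Or.inr ⟨i, j, h, rfl, rfl⟩

theorem chainGraph_adj_bridge (i : Fin k) (z : T.neighborSet i) :
    (chainGraph T H c).Adj ⟨i, c i z⟩ ⟨z, c z ⟨i, z.2.symm⟩⟩ :=
  Or.inr ⟨i, z, z.2, rfl, rfl⟩

theorem reachable_block {K : SimpleGraph (Σ i, V i)} {i : Fin k} (hH : (H i).Connected)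
    (hK : ∀ a b, (H i).Adj a b → K.Adj ⟨i, a⟩ ⟨i, b⟩) (a b : V i) : K.Reachable ⟨i, a⟩ ⟨i, b⟩ :=
  (hH.preconnected a b).map (⟨fun a => ⟨i, a⟩, fun {_ _} h => hK _ _ h⟩ : H i →g K)

theorem chainGraph_connected (hT : T.Connected) (hH : ∀ i, (H i).Connected) :
    (chainGraph T H c).Connected := by
  have key : ∀ {i l : Fin k}, T.Walk i l → ∀ (a : V i) (b : V l),
      (chainGraph T H c).Reachable ⟨i, a⟩ ⟨l, b⟩ := by
    intro i l p
    induction p with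
    | nil => exact reachable_block (hH _) fun _ _ h => chainGraph_adj_mk.2 h
    | @cons u v w h q ih =>
      intro a b
      exact ((reachable_block (hH u) (fun _ _ h => chainGraph_adj_mk.2 h) a (c u ⟨v, h⟩)).trans
        (chainGraph_adj_bridge u ⟨v, h⟩).reachable).trans (ih _ b)
  obtain ⟨o⟩ := hT.nonempty
  obtain ⟨a⟩ := (hH o).nonempty
  have : Nonempty (Σ i, V i) := ⟨⟨o, a⟩⟩
  refine ⟨fun x y => ?_⟩
  obtain ⟨p⟩ := hT.preconnected x.1 y.1
  exact key p x.2 y.2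

/-- Being on the far side is invariant along the edges that survive the deletion. Conversely, a
near-side block is joined to block `i` by induction on its tree distance to `i`, using only
surviving bridges. -/
theorem mem_supp_side_iff (hT : T.IsTree) (hH : ∀ i, (H i).Connected) (i : Fin k)
    (z : T.neighborSet i) (x : Σ i, V i) :
    x ∈ (((chainGraph T H c).deleteEdges {s(⟨i, c i z⟩, ⟨z, c z ⟨i, z.2.symm⟩⟩)}).connectedComponentMk
      ⟨i, c i z⟩).supp ↔ ¬ FarSide T i z x.1 := by
  obtain ⟨j, hij⟩ := z
  have hij' : T.Adj i j := hij
  set G' := (chainGraph T H c).deleteEdges {s(⟨i, c i ⟨j, hij⟩⟩, ⟨j, c j ⟨i, hij'.symm⟩⟩)} with hG'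
  rw [SimpleGraph.ConnectedComponent.mem_supp_iff, SimpleGraph.ConnectedComponent.eq]
  have hblock : ∀ l (a b : V l), (H l).Adj a b → G'.Adj ⟨l, a⟩ ⟨l, b⟩ := by
    intro l a b h
    rw [hG', SimpleGraph.deleteEdges_adj]
    refine ⟨chainGraph_adj_mk.2 h, ?_⟩
    rw [Set.mem_singleton_iff, Sym2.eq_iff]
    rintro (⟨h1, h2⟩ | ⟨h1, h2⟩)
    · exact hij'.ne ((Sigma.mk.inj h1).1.symm.trans (Sigma.mk.inj h2).1)
    · exact hij'.ne ((Sigma.mk.inj h2).1.symm.trans (Sigma.mk.inj h1).1)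
  have hbridge : ∀ u v (h : T.Adj u v), ¬ (u = j ∧ v = i) → ¬ (u = i ∧ v = j) →
      G'.Adj ⟨u, c u ⟨v, h⟩⟩ ⟨v, c v ⟨u, h.symm⟩⟩ := by
    intro u v h hne1 hne2
    rw [hG', SimpleGraph.deleteEdges_adj]
    refine ⟨chainGraph_adj_bridge u ⟨v, h⟩, ?_⟩
    rw [Set.mem_singleton_iff, Sym2.eq_iff]
    rintro (⟨h1, h2⟩ | ⟨h1, h2⟩)
    · exact hne2 ⟨(Sigma.mk.inj h1).1, (Sigma.mk.inj h2).1⟩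
    · exact hne1 ⟨(Sigma.mk.inj h1).1, (Sigma.mk.inj h2).1⟩
  have hinv : ∀ x y, G'.Adj x y → (FarSide T i j x.1 ↔ FarSide T i j y.1) := by
    intro x y hxy
    rw [hG', SimpleGraph.deleteEdges_adj] at hxy
    obtain ⟨⟨l, a, b, h, rfl, rfl⟩ | ⟨u, v, h, rfl, rfl⟩, hne⟩ := hxy
    · exact Iff.rfl
    · refine farSide_congr hT hij' h ?_ ?_
      · rintro ⟨rfl, rfl⟩
        exact hne Sym2.eq_swap
      · rintro ⟨rfl, rfl⟩
        exact hne rfl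
  constructor
  · rintro ⟨p⟩
    have : ∀ {x y}, G'.Walk x y → (FarSide T i j x.1 ↔ FarSide T i j y.1) := by
      intro x y p
      induction p with
      | nil => exact Iff.rfl
      | cons h q ih => exact (hinv _ _ h).trans ih
    rw [this p]
    exact not_farSide_self i j
  · have key : ∀ n l, T.dist l i = n → ¬ FarSide T i j l → ∀ b : V l,
        G'.Reachable ⟨l, b⟩ ⟨i, c i ⟨j, hij⟩⟩ := by
      intro n
      induction n with
      | zero =>
        intro l hl _ b
        obtain rfl := (hT.connected.dist_eq_zero_iff).1 hl
        exact reachable_block (hH l) (hblock l) _ _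
      | succ n ih =>
        intro l hl hf b
        have hne : i ≠ l := by
          rintro rfl
          simp at hl
        obtain ⟨u, hu, hfu⟩ := exists_farSide hT hne
        have hlj : l ≠ j := by
          rintro rfl
          exact hf (farSide_of_adj hij')
        have h1 : ¬ (l = j ∧ u = i) := fun h => hlj h.1
        have h2 : ¬ (l = i ∧ u = j) := fun h => hne h.1.symm
        have hd : T.dist u i = n := by
          have := dist_eq_or hT hu i
          unfold FarSide at hfu
          omega
        exact ((reachable_block (hH l) (hblock l) b (c l ⟨u, hu⟩)).trans
          (hbridge l u hu h1 h2).reachable).trans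
            (ih u hd (by rwa [← farSide_congr hT hij' hu h1 h2]) _)
    exact fun hf => key _ x.1 rfl hf x.2

variable [∀ i, Fintype (V i)]

open Classical in
/-- The degrees on the side of `z` of the bridge `i ∼ z`. -/
theorem sum_degVec_farSide (hT : T.IsTree) (hH : ∀ i, (H i).Connected) (i : Fin k)
    (z : T.neighborSet i) :
    ∑ x, (if FarSide T i z x.1 then degVec (chainGraph T H c) x else 0) =
      2 * bridgeWbar T H c i z - 1 := by
  obtain ⟨S, hS⟩ : ∃ S : Set (Σ i, V i), ∀ x, x ∈ S ↔ ¬ FarSide T i z x.1 :=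
    ⟨{x | ¬ FarSide T i z x.1}, fun _ => Iff.rfl⟩
  have h := sum_degVec_side (chainGraph T H c) (chainGraph_adj_bridge (H := H) (c := c) i z)
    (S := S) (Set.ext fun x => (mem_supp_side_iff hT hH i z x).trans (hS x).symm)
    (fun h => (hS _).1 h (farSide_of_adj z.2))
  have h2 : ∑ x, (if FarSide T i z x.1 then degVec (chainGraph T H c) x else 0) +
      ∑ x, (if x ∈ S then degVec (chainGraph T H c) x else 0) =
      2 * (numEdges (chainGraph T H c) : ℝ) := by
    rw [← sum_degVec, ← Finset.sum_add_distrib]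
    refine Finset.sum_congr rfl fun x _ => ?_
    by_cases hx : FarSide T i z x.1 <;> simp [hS, hx]
  -- The near side has degree sum `2 W + 1`, so `2 m - 2 W - 1 = 2 W̄ - 1` is left.
  rw [h] at h2
  rw [bridgeWbar, bridgeW]
  linarith

open Classical in
theorem sum_chainGraph_adj [DecidableRel T.Adj] (F : (Σ i, V i) → ℝ) (i : Fin k) (a : V i) :
    (∑ y, if (chainGraph T H c).Adj ⟨i, a⟩ y then F y else 0) =
      (∑ b, if (H i).Adj a b then F ⟨i, b⟩ else 0) +
        ∑ z : T.neighborSet i, if c i z = a then F ⟨z, c z ⟨i, z.2.symm⟩⟩ else 0 := by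
  rw [Fintype.sum_sigma, sum_neighborSet]
  have h : ∀ j, (∑ b : V j, if (chainGraph T H c).Adj ⟨i, a⟩ ⟨j, b⟩ then F ⟨j, b⟩ else 0) =
      (if j = i then (∑ b, if (H i).Adj a b then F ⟨i, b⟩ else 0) else 0) +
      if h : T.Adj i j then (if c i ⟨j, h⟩ = a then F ⟨j, c j ⟨i, h.symm⟩⟩ else 0) else 0 := by
    intro j
    by_cases hj : j = i
    · subst hj
      simp [chainGraph_adj_mk]
    · rw [if_neg hj, zero_add]
      simp only [chainGraph_adj_of_ne (Ne.symm hj)]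
      by_cases hadj : T.Adj i j
      · rw [dif_pos hadj]
        by_cases hc : c i ⟨j, hadj⟩ = a
        · simp [hadj, hc]
        · simp [hadj, hc]
      · simp [hadj]
  simp only [h, Finset.sum_add_distrib, Finset.sum_ite_eq', Finset.mem_univ, if_true]

open Classical in
theorem degVec_chainGraph [DecidableRel T.Adj] (i : Fin k) (a : V i) :
    degVec (chainGraph T H c) ⟨i, a⟩ =
      degVec (H i) a + ∑ z : T.neighborSet i, if c i z = a then 1 else 0 := by
  rw [degVec_eq_sum, degVec_eq_sum, sum_chainGraph_adj]

end Chain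

/-! ### Projections to the blocks, resistances and weighted sums -/

section Projection

variable {k : ℕ} {T : SimpleGraph (Fin k)} {V : Fin k → Type*}
  {H : ∀ i, SimpleGraph (V i)} {c : ∀ i, T.neighborSet i → V i}

open Classical in
/-- The projection of a chain to its `i`-th part: vertices outside of this part go to the end vertex
of the bridge leading to them. -/
noncomputable def chainProj (hT : T.IsTree) (c : ∀ i, T.neighborSet i → V i) (i : Fin k)
    (x : Σ i, V i) : V i :=
  if h : x.1 = i then h ▸ x.2
  else c i ⟨(exists_farSide hT h).choose, (exists_farSide hT h).choose_spec.1⟩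

theorem chainProj_mk (hT : T.IsTree) (i : Fin k) (a : V i) : chainProj hT c i ⟨i, a⟩ = a := by
  simp [chainProj]

theorem chainProj_of_farSide (hT : T.IsTree) {i : Fin k} (z : T.neighborSet i) {x : Σ i, V i}
    (hx : FarSide T i z x.1) : chainProj hT c i x = c i z := by
  have hne : x.1 ≠ i := by
    intro h
    rw [h] at hx
    exact not_farSide_self _ _ hx
  rw [chainProj, dif_neg hne]
  congr 1
  exact Subtype.ext (farSide_unique hT (exists_farSide hT hne).choose_spec.1 z.2
    (exists_farSide hT hne).choose_spec.2 hx)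

theorem chainProj_block (hT : T.IsTree) {l i : Fin k} (hl : i ≠ l) (a b : V i) :
    chainProj hT c l ⟨i, a⟩ = chainProj hT c l ⟨i, b⟩ := by
  obtain ⟨j, hj, hf⟩ := exists_farSide hT hl
  rw [chainProj_of_farSide hT ⟨j, hj⟩ (x := ⟨i, a⟩) hf,
    chainProj_of_farSide hT ⟨j, hj⟩ (x := ⟨i, b⟩) hf]

/-- Crossing a bridge moves no projection: it ends at its own attaching vertex in block `l`, or
stays on one side of every edge at `l`. In the resistance formula a bridge thus affects only the
distance term. -/
theorem chainProj_bridge (hT : T.IsTree) (l i : Fin k) (z : T.neighborSet i) :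
    chainProj hT c l ⟨i, c i z⟩ = chainProj hT c l ⟨z, c z ⟨i, z.2.symm⟩⟩ := by
  obtain ⟨j, hij⟩ := z
  have hij' : T.Adj i j := hij
  by_cases hi : i = l
  · subst hi
    rw [chainProj_mk, chainProj_of_farSide hT ⟨j, hij⟩ (farSide_of_adj hij')]
  by_cases hj : j = l
  · subst hj
    rw [chainProj_mk, chainProj_of_farSide hT ⟨i, hij'.symm⟩ (farSide_of_adj hij'.symm)]
  obtain ⟨s, hs, hf⟩ := exists_farSide hT hi
  have hf' : FarSide T l s j :=
    (farSide_congr hT hs hij' (fun h => hj h.2) (fun h => hi h.1)).1 hf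
  rw [chainProj_of_farSide hT ⟨s, hs⟩ (x := ⟨i, c i ⟨j, hij⟩⟩) hf,
    chainProj_of_farSide hT ⟨s, hs⟩ (x := ⟨j, c j ⟨i, hij'.symm⟩⟩) hf']

open Classical in
theorem apply_chainProj [DecidableRel T.Adj] (hT : T.IsTree) (i : Fin k) (f : V i → ℝ)
    (x : Σ i, V i) :
    f (chainProj hT c i x) = (if x.1 = i then f (chainProj hT c i x) else 0) +
      ∑ z : T.neighborSet i, if FarSide T i z x.1 then f (c i z) else 0 := by
  by_cases hx : x.1 = i
  · rw [if_pos hx, Finset.sum_eq_zero, add_zero]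
    intro z _
    rw [if_neg]
    rw [hx]
    exact not_farSide_self _ _
  · obtain ⟨j, hj, hf⟩ := exists_farSide hT hx
    rw [if_neg hx, zero_add, Fintype.sum_eq_single (⟨j, hj⟩ : T.neighborSet i)]
    · rw [if_pos hf, chainProj_of_farSide hT ⟨j, hj⟩ hf]
    · intro z hz
      rw [if_neg]
      exact fun h => hz (Subtype.ext (farSide_unique hT z.2 hj h hf))

variable [∀ i, Fintype (V i)]

/-- Effective resistances in a chain. -/
theorem resistance_chainGraph (hT : T.IsTree) (hH : ∀ i, (H i).Connected) (x y : Σ i, V i) :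
    resistance (chainGraph T H c) x y =
      ∑ l, resistance (H l) (chainProj hT c l x) (chainProj hT c l y) + T.dist x.1 y.1 := by
  classical
  choose σ hσ using fun i => exists_sum_resistance_sub (hH i)
  set D : (Σ i, V i) → (Σ i, V i) → ℝ := fun x y =>
    ∑ l, resistance (H l) (chainProj hT c l x) (chainProj hT c l y) + T.dist x.1 y.1 with hD
  refine (eq_resistance (D := D) (chainGraph_connected hT.connected hH) ?_ ?_
    -- Each bridge at `x` contributes `+1` to the Laplacian if `y` lies across it and `-1`
    -- otherwise, that is `2 · [y across] - 1`; the `-1` is independent of `y` and goes into `τ`.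
    (fun x => σ x.1 x.2 - ∑ z : T.neighborSet x.1, if c x.1 z = x.2 then 1 else 0) ?_ x y).symm
  · intro x y
    simp only [hD, SimpleGraph.dist_comm (u := x.1)]
    congr 1
    exact Finset.sum_congr rfl fun l _ => resistance_comm _ _ _
  · intro x
    simp [hD, resistance_self]
  · rintro ⟨i, a⟩ y
    have hin : ∀ b, D ⟨i, a⟩ y - D ⟨i, b⟩ y =
        resistance (H i) a (chainProj hT c i y) - resistance (H i) b (chainProj hT c i y) := by
      intro b
      simp only [hD, add_sub_add_right_eq_sub]
      rw [← Finset.sum_sub_distrib, Fintype.sum_eq_single i]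
      · rw [chainProj_mk, chainProj_mk]
      · intro l hl
        rw [chainProj_block hT hl.symm a b, sub_self]
    have hbr : ∀ z : T.neighborSet i, c i z = a → D ⟨i, a⟩ y - D ⟨z, c z ⟨i, z.2.symm⟩⟩ y =
        2 * (if FarSide T i z y.1 then 1 else 0) - 1 := by
      rintro z rfl
      simp only [hD, chainProj_bridge hT _ i z, add_sub_add_left_eq_sub]
      rcases dist_eq_or hT z.2 y.1 with h | h
      · have hf : FarSide T i z y.1 := by unfold FarSide; omega
        rw [if_pos hf, h]
        push_cast
        ring
      · have hf : ¬ FarSide T i z y.1 := by unfold FarSide; omega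
        rw [if_neg hf, h]
        push_cast
        ring
    rw [sum_chainGraph_adj (fun w => D ⟨i, a⟩ y - D w y)]
    simp only [hin]
    rw [hσ i a]
    have e1 : (∑ z : T.neighborSet i,
        if c i z = a then D ⟨i, a⟩ y - D ⟨z, c z ⟨i, z.2.symm⟩⟩ y else 0) =
        2 * (∑ z : T.neighborSet i, if FarSide T i z y.1 then (if c i z = a then (1 : ℝ) else 0) else 0)
          - ∑ z : T.neighborSet i, if c i z = a then 1 else 0 := by
      rw [Finset.mul_sum, ← Finset.sum_sub_distrib]
      refine Finset.sum_congr rfl fun z _ => ?_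
      by_cases hz : c i z = a
      · simp only [if_pos hz, hbr z hz]
      · simp [if_neg hz]
    -- A vertex projects to `a` if it is `a` itself or lies across a bridge at `a`. The second case
    -- cancels the bridge terms `+2`, leaving `-2 · [y = (i, a)]`.
    have e2 := apply_chainProj (c := c) hT i (fun b => if b = a then (1 : ℝ) else 0) y
    have e3 : (if chainProj hT c i y = a then (2 : ℝ) else 0) =
        2 * if chainProj hT c i y = a then 1 else 0 := by split_ifs <;> norm_num
    have e4 : (if y.1 = i then (if chainProj hT c i y = a then (1 : ℝ) else 0) else 0) =
        if y = ⟨i, a⟩ then 1 else 0 := by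
      obtain ⟨j, b⟩ := y
      by_cases hj : j = i
      · subst hj
        simp [chainProj_mk]
      · have : (⟨j, b⟩ : Σ i, V i) ≠ ⟨i, a⟩ := fun h => hj (Sigma.mk.inj h).1
        simp [hj, this]
    rw [e1, e3, e2, e4]
    by_cases hy : y = ⟨i, a⟩
    · rw [if_pos hy, if_pos hy]
      ring
    · rw [if_neg hy, if_neg hy]
      ring

variable [DecidableRel T.Adj]

theorem sum_degVec_mul_apply_chainProj (hT : T.IsTree) (hH : ∀ i, (H i).Connected) (i : Fin k)
    (f : V i → ℝ) :
    ∑ x, degVec (chainGraph T H c) x * f (chainProj hT c i x) =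
      ∑ a, degVec (H i) a * f a + 2 * ∑ z : T.neighborSet i, bridgeWbar T H c i z * f (c i z) := by
  classical
  have e1 : ∑ x, degVec (chainGraph T H c) x * f (chainProj hT c i x) =
      ∑ x, degVec (chainGraph T H c) x * (if x.1 = i then f (chainProj hT c i x) else 0) +
      ∑ z : T.neighborSet i, f (c i z) *
        ∑ x, if FarSide T i z x.1 then degVec (chainGraph T H c) x else 0 := by
    simp only [Finset.mul_sum]
    rw [Finset.sum_comm, ← Finset.sum_add_distrib]
    refine Finset.sum_congr rfl fun x _ => ?_
    conv_lhs => rw [apply_chainProj hT i f x]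
    rw [mul_add, Finset.mul_sum]
    congr 1
    refine Finset.sum_congr rfl fun z _ => ?_
    split_ifs <;> ring
  -- Every bridge at block `i` adds one to the degree of its end `c i z`; with the far-side total `2
  -- W̄ - 1` this makes the weight `2 W̄`.
  have e2 : ∑ x, degVec (chainGraph T H c) x * (if x.1 = i then f (chainProj hT c i x) else 0) =
      ∑ a, degVec (H i) a * f a + ∑ z : T.neighborSet i, f (c i z) := by
    rw [Fintype.sum_sigma, Fintype.sum_eq_single i]
    · simp only [if_true, chainProj_mk, degVec_chainGraph, add_mul, Finset.sum_add_distrib,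
        Finset.sum_mul]
      congr 1
      rw [Finset.sum_comm]
      refine Finset.sum_congr rfl fun z _ => ?_
      simp
    · intro j hj
      simp [hj]
  rw [e1, e2, Finset.mul_sum, add_assoc, ← Finset.sum_add_distrib]
  congr 1
  refine Finset.sum_congr rfl fun z _ => ?_
  rw [sum_degVec_farSide hT hH]
  ring

theorem moment_eq_sum {W : Type*} [Fintype W] (G : SimpleGraph W) (v : W) :
    moment G v = ∑ u, degVec G u * resistance G u v := by
  classical
  simp [moment, resistanceMatrix, dotProduct]

/-- The contribution of the `i`-th part to the weighted sum of the resistances of a chain. -/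
theorem sum_degVec_mul_resistance_chainProj (hT : T.IsTree) (hH : ∀ i, (H i).Connected)
    (i : Fin k) :
    ∑ x, ∑ y, degVec (chainGraph T H c) x * degVec (chainGraph T H c) y *
      resistance (H i) (chainProj hT c i x) (chainProj hT c i y) =
    4 * (numEdges (H i) : ℝ) * kemeny (H i) +
      4 * (∑ z : T.neighborSet i, bridgeWbar T H c i z * moment (H i) (c i z)) +
      4 * ∑ z₁ : T.neighborSet i, ∑ z₂ : T.neighborSet i,
        bridgeWbar T H c i z₁ * bridgeWbar T H c i z₂ * resistance (H i) (c i z₁) (c i z₂) := by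
  -- The push-forward of the degrees is applied once in `y`, giving `g`, and once in `x`.
  set g : V i → ℝ := fun a => ∑ y, degVec (chainGraph T H c) y *
    resistance (H i) a (chainProj hT c i y) with hg
  have hg' : ∀ a, g a = ∑ b, degVec (H i) b * resistance (H i) a b +
      2 * ∑ z : T.neighborSet i, bridgeWbar T H c i z * resistance (H i) a (c i z) := fun a =>
    sum_degVec_mul_apply_chainProj hT hH i (fun b => resistance (H i) a b)
  have e1 : ∑ x, ∑ y, degVec (chainGraph T H c) x * degVec (chainGraph T H c) y *
      resistance (H i) (chainProj hT c i x) (chainProj hT c i y) =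
      ∑ x, degVec (chainGraph T H c) x * g (chainProj hT c i x) := by
    refine Finset.sum_congr rfl fun x _ => ?_
    simp only [hg, Finset.mul_sum, mul_assoc]
  have hmom : ∀ a, ∑ b, degVec (H i) b * resistance (H i) a b = moment (H i) a := by
    intro a
    rw [moment_eq_sum]
    exact Finset.sum_congr rfl fun b _ => by rw [resistance_comm]
  have e2 : ∑ a, degVec (H i) a * g a = 4 * (numEdges (H i) : ℝ) * kemeny (H i) +
      2 * ∑ z : T.neighborSet i, bridgeWbar T H c i z * moment (H i) (c i z) := by
    rw [four_mul_numEdges_mul_kemeny (hH i)]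
    simp only [hg', mul_add, Finset.sum_add_distrib]
    congr 1
    · refine Finset.sum_congr rfl fun a _ => ?_
      rw [Finset.mul_sum]
      exact Finset.sum_congr rfl fun b _ => by ring
    · simp only [moment_eq_sum, Finset.mul_sum]
      rw [Finset.sum_comm]
      exact Finset.sum_congr rfl fun z _ => Finset.sum_congr rfl fun a _ => by ring
  have e3 : ∑ z : T.neighborSet i, bridgeWbar T H c i z * g (c i z) =
      ∑ z : T.neighborSet i, bridgeWbar T H c i z * moment (H i) (c i z) +
      2 * ∑ z₁ : T.neighborSet i, ∑ z₂ : T.neighborSet i,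
        bridgeWbar T H c i z₁ * bridgeWbar T H c i z₂ * resistance (H i) (c i z₁) (c i z₂) := by
    rw [Finset.mul_sum, ← Finset.sum_add_distrib]
    refine Finset.sum_congr rfl fun z _ => ?_
    rw [hg', hmom, mul_add]
    congr 1
    simp only [Finset.mul_sum]
    exact Finset.sum_congr rfl fun z₂ _ => by ring
  rw [e1, sum_degVec_mul_apply_chainProj hT hH i g, e2, e3]
  ring

/-- The contribution of the bridges to the weighted sum of the resistances of a chain. -/
theorem sum_degVec_mul_dist (hT : T.IsTree) (hH : ∀ i, (H i).Connected) :
    ∑ x, ∑ y, degVec (chainGraph T H c) x * degVec (chainGraph T H c) y * (T.dist x.1 y.1 : ℝ) =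
    2 * ∑ e : TreeEdge T,
      (2 * bridgeWbar T H c e.i e.toJ - 1) * (2 * bridgeWbar T H c e.j e.toI - 1) := by
  classical
  set d := degVec (chainGraph T H c)
  -- A separated pair lies across `e` in one of two orders; each order sums to the product of the
  -- two side totals.
  have e1 : ∀ x y : Σ i, V i, d x * d y * (T.dist x.1 y.1 : ℝ) = ∑ e : TreeEdge T,
      ((if FarSide T e.i e.j x.1 then d x else 0) * (if FarSide T e.j e.i y.1 then d y else 0) +
      (if FarSide T e.j e.i x.1 then d x else 0) * (if FarSide T e.i e.j y.1 then d y else 0)) := by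
    intro x y
    rw [dist_eq_sum_treeEdge hT, Finset.mul_sum]
    refine Finset.sum_congr rfl fun e _ => ?_
    simp only [← not_farSide_iff hT e.2.2]
    by_cases hx : FarSide T e.i e.j x.1 <;> by_cases hy : FarSide T e.i e.j y.1 <;> simp [hx, hy]
  simp only [e1]
  rw [Finset.sum_congr rfl fun x _ => Finset.sum_comm, Finset.sum_comm, Finset.mul_sum]
  refine Finset.sum_congr rfl fun e _ => ?_
  simp only [Finset.sum_add_distrib, ← Finset.sum_mul_sum]
  have h1 := sum_degVec_farSide (c := c) hT hH e.i e.toJ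
  have h2 := sum_degVec_farSide (c := c) hT hH e.j e.toI
  rw [← h1, ← h2]
  ring

end Projection

end KemenyChain

theorem theorem3p6 {k : ℕ} (T : SimpleGraph (Fin k)) [DecidableRel T.Adj] (hT : T.IsTree)
    (V : Fin k → Type*) [∀ i, Fintype (V i)] (H : ∀ i, SimpleGraph (V i))
    (hH : ∀ i, (H i).Connected) (c : ∀ i, T.neighborSet i → V i) :
    kemeny (chainGraph T H c) =
      (∑ i, (numEdges (H i) : ℝ) / numEdges (chainGraph T H c) * kemeny (H i))
      + (∑ e : TreeEdge T,
          (bridgeWbar T H c e.i e.toJ / numEdges (chainGraph T H c)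
              * moment (H e.i) (c e.i e.toJ)
            + bridgeWbar T H c e.j e.toI / numEdges (chainGraph T H c)
              * moment (H e.j) (c e.j e.toI)))
      + (∑ i, ∑ z₁ : T.neighborSet i, ∑ z₂ : T.neighborSet i,
          bridgeWbar T H c i z₁ * bridgeWbar T H c i z₂ / numEdges (chainGraph T H c)
            * resistance (H i) (c i z₁) (c i z₂))
      + (∑ e : TreeEdge T,
          (2 * bridgeWbar T H c e.i e.toJ - 1) * (2 * bridgeWbar T H c e.j e.toI - 1)
            / (2 * (numEdges (chainGraph T H c) : ℝ))) := by
  by_cases hm : numEdges (chainGraph T H c) = 0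
  -- Division by `m = 0` makes the stationary vector and every term on the right `0`, which matches
  -- the convention for a single vertex.
  · simp [hm, kemeny, kemenyOfChain, stationary]
  have hm' : (numEdges (chainGraph T H c) : ℝ) ≠ 0 := Nat.cast_ne_zero.2 hm
  have h := four_mul_numEdges_mul_kemeny (chainGraph_connected (c := c) hT.connected hH)
  simp only [resistance_chainGraph hT hH, mul_add, Finset.sum_add_distrib, Finset.mul_sum] at h
  rw [Finset.sum_congr rfl fun x _ => Finset.sum_comm, Finset.sum_comm,
    Finset.sum_congr rfl fun i _ => sum_degVec_mul_resistance_chainProj hT hH i,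
    sum_degVec_mul_dist hT hH, Finset.sum_add_distrib, Finset.sum_add_distrib, ← Finset.mul_sum,
    ← Finset.mul_sum] at h
  rw [sum_treeEdge_add fun i z => bridgeWbar T H c i z / numEdges (chainGraph T H c)
    * moment (H i) (c i z)]
  refine mul_left_cancel₀ (mul_ne_zero four_ne_zero hm') (h.trans ?_)
  simp only [div_mul_eq_mul_div, ← Finset.sum_div]
  simp only [mul_assoc, ← Finset.mul_sum]
  field_simp
  ring
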